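/- Let $N$ be a natural number, $M=\{1,\dots,N\}$, and let $\{A(n)\}_{n\ge 0}$ be a chain of (row-)stochastic $N\times N$ real matrices. Suppose that $\{A(n)\}$ is - self-confident: there is $\delta>0$ such that $A_{ii}(n)\ge\delta$ for all $i\in M$ and $n\ge 0$; and - cut-balanced: there is a constant $\Psi$ such that for every $M_1\subseteq M$ and every $n\ge 0$, $$\sum_{i\notin M_1}\sum_{j\in M_1}A_{ij}(n)\;\le\;\Psi\sum_{i\in M_1}\sum_{j\notin M_1}A_{ij}(n).$$ Then $\{A(n)\}$ is class-ergodic, that is: (i) for every $n_0\ge 0$ the product $A(n)A(n-1)\cdots A(n_0)$ converges as $n\to\infty$; and (ii) $M$ can be partitioned into ergodic classes, where $i,j\in M$ belong to the same ergodic class if and only if, for every $n_0\ge 0$, the difference between the $i$th and the $j$th row of $A(n)A(n-1)\cdots A(n_0)$ tends to $0$ as $n\to\infty$. Moreover, the islands of $\{A(n)\}$ are exactly its ergodic classes. Here the islands are the node sets of the connected components of the infinite flow graph of $\{A(n)\}$, the simple graph on $M$ in which distinct $i,j$ are adjacent if and only if $\sum_{n=0}^{\infty}\bigl(A_{ij}(n)+A_{ji}(n)\bigr)=\infty$.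 -/

import Mathlib

open Filter Topology

/-- A chain `A(0), A(1), …` of row-stochastic `N × N` real matrices. -/
def IsStochasticChain {N : ℕ} (A : ℕ → Matrix (Fin N) (Fin N) ℝ) : Prop :=
  ∀ n, A n ∈ Matrix.rowStochastic ℝ (Fin N)

/-- The backward product `A(n₀ + k - 1) ⋯ A(n₀ + 1) A(n₀)` of `k` factors. -/
def backwardProd {N : ℕ} (A : ℕ → Matrix (Fin N) (Fin N) ℝ) (n₀ : ℕ) :
    ℕ → Matrix (Fin N) (Fin N) ℝ
  | 0 => 1
  | k + 1 => A (n₀ + k) * backwardProd A n₀ k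

/-- For every starting time, the difference between the `i`-th and the `j`-th row of the
backward product vanishes asymptotically. -/
def MutuallyErgodic {N : ℕ} (A : ℕ → Matrix (Fin N) (Fin N) ℝ) (i j : Fin N) : Prop :=
  ∀ n₀ : ℕ, Tendsto (fun k => backwardProd A n₀ k i - backwardProd A n₀ k j) atTop (𝓝 0)

/-- `𝒞` is the partition of the index set into ergodic classes: a partition into nonempty sets in
which two indices share a class exactly when they are mutually ergodic. -/
def IsErgodicClassPartition {N : ℕ} (A : ℕ → Matrix (Fin N) (Fin N) ℝ)
    (𝒞 : Set (Set (Fin N))) : Prop :=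
  Setoid.IsPartition 𝒞 ∧ ∀ i j : Fin N, (∃ C ∈ 𝒞, i ∈ C ∧ j ∈ C) ↔ MutuallyErgodic A i j

/-- The backward product from every starting time converges, and the index set is partitioned
into ergodic classes. -/
def IsClassErgodic {N : ℕ} (A : ℕ → Matrix (Fin N) (Fin N) ℝ) : Prop :=
  (∀ n₀ : ℕ, ∃ L : Matrix (Fin N) (Fin N) ℝ, Tendsto (backwardProd A n₀) atTop (𝓝 L)) ∧
    ∃ 𝒞 : Set (Set (Fin N)), IsErgodicClassPartition A 𝒞

/-- The infinite flow graph: distinct `i`, `j` are adjacent iff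
`∑ₙ (A_{ij}(n) + A_{ji}(n)) = ∞`. -/
def infiniteFlowGraph {N : ℕ} (A : ℕ → Matrix (Fin N) (Fin N) ℝ) : SimpleGraph (Fin N) where
  Adj i j := i ≠ j ∧
    Tendsto (fun m => ∑ n ∈ Finset.range m, (A n i j + A n j i)) atTop atTop
  symm := ⟨fun i j h => ⟨h.1.symm, by simpa only [add_comm] using h.2⟩⟩
  loopless := ⟨fun _ h => h.1 rfl⟩

/-- The islands: the node sets of the connected components of the infinite flow graph. -/
def islands {N : ℕ} (A : ℕ → Matrix (Fin N) (Fin N) ℝ) : Set (Set (Fin N)) :=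
  Set.range fun c : (infiniteFlowGraph A).ConnectedComponent => c.supp

/-- The diagonal entries are bounded below by some `δ > 0`, uniformly in time. -/
def IsSelfConfident {N : ℕ} (A : ℕ → Matrix (Fin N) (Fin N) ℝ) : Prop :=
  ∃ δ : ℝ, 0 < δ ∧ ∀ (i : Fin N) (n : ℕ), δ ≤ A n i i

/-- Some bound `Ψ` compares the two directions of flow across every cut at every time. -/
def IsCutBalanced {N : ℕ} (A : ℕ → Matrix (Fin N) (Fin N) ℝ) : Prop :=
  ∃ Ψ : ℝ, ∀ (S : Finset (Fin N)) (n : ℕ),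
    ∑ i ∈ Sᶜ, ∑ j ∈ S, A n i j ≤ Ψ * ∑ i ∈ S, ∑ j ∈ Sᶜ, A n i j

/-!
Along a trajectory `x (n + 1) = A n * x n`, a sum of squares `∑ i, u i * x i ^ 2` is nonincreasing
when the weights are transported backwards in time by `u ↦ u * A n`; because of the diagonal, it
decreases at each step by at least `δ * min u` times the dissipation
`∑ i j, A n i j * (x n i - x n j) ^ 2`. Cut-balance and self-confidence keep the weights, started
from `1` at any horizon, above a constant that does not depend on the horizon: `IsSpread.vecMul`
shows that the bounds `(δ / (1 + Ψ)) ^ (N - |S|)` for the mass of every nonempty set `S` are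
preserved. Hence the dissipation is summable (`summable_dissipation`).

Suppose that at a late time the coordinates in `S` are separated by a gap from the others. While
the gap lasts, the small remaining dissipation bounds the flow across the cut, and a small flow
cannot close the gap; so the gap lasts forever and the total flow across the cut is finite
(`summable_cutFlow_of_gap`). By pigeonhole, a large difference between two coordinates contains a
gap, so coordinates adjacent in the infinite flow graph have differences tending to `0`. Only a
finite total flow crosses the border of an island, so that the common value on an island is a
Cauchy sequence. This applies to the columns of the backward products. Conversely, when the
indicator function of the complement of an island is taken as the initial value at a late time,
the finite flow across the border cannot bring the two sides together, so different islands are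
not mutually ergodic.
-/

/-- `x` is a trajectory of the chain `A`: it evolves by `x (n + 1) = A n * x n`, with all values
in `[0, 1]`. -/
structure IsUnitTrajectory {N : ℕ} (A : ℕ → Matrix (Fin N) (Fin N) ℝ) (x : ℕ → Fin N → ℝ) :
    Prop where
  step : ∀ n i, x (n + 1) i = ∑ j, A n i j * x n j
  nonneg : ∀ n i, 0 ≤ x n i
  le_one : ∀ n i, x n i ≤ 1

/-- The total flow at time `n` between `S` and its complement, in both directions. -/
def cutFlow {N : ℕ} (A : ℕ → Matrix (Fin N) (Fin N) ℝ) (S : Finset (Fin N)) (n : ℕ) : ℝ :=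
  ∑ i ∈ S, ∑ j ∈ Sᶜ, (A n i j + A n j i)

/-- The dissipation at time `n`: the squared differences of `x n`, weighted by the entries
of `A n`. -/
def dissipation {N : ℕ} (A : ℕ → Matrix (Fin N) (Fin N) ℝ) (x : ℕ → Fin N → ℝ) (n : ℕ) : ℝ :=
  ∑ i, ∑ j, A n i j * (x n i - x n j) ^ 2

/-- Nonnegative weights `u` for which every nonempty set `S` carries mass at least
`ε ^ (N - |S|)`. -/
def IsSpread {N : ℕ} (ε : ℝ) (u : Fin N → ℝ) : Prop :=
  (∀ i, 0 ≤ u i) ∧ ∀ S : Finset (Fin N), S.Nonempty → ε ^ (N - S.card) ≤ ∑ i ∈ S, u i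

variable {N : ℕ} {A : ℕ → Matrix (Fin N) (Fin N) ℝ} {x : ℕ → Fin N → ℝ}

theorem IsStochasticChain.nonneg (hA : IsStochasticChain A) (n : ℕ) (i j : Fin N) :
    0 ≤ A n i j := (hA n).1 i j

theorem IsStochasticChain.sum_row (hA : IsStochasticChain A) (n : ℕ) (i : Fin N) :
    ∑ j, A n i j = 1 := Matrix.sum_row_of_mem_rowStochastic (hA n) i

theorem IsStochasticChain.shift (hA : IsStochasticChain A) (t : ℕ) :
    IsStochasticChain (fun n => A (n + t)) := fun n => hA (n + t)

theorem IsUnitTrajectory.shift (hx : IsUnitTrajectory A x) (t : ℕ) :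
    IsUnitTrajectory (fun n => A (n + t)) (fun n => x (n + t)) where
  step n i := by
    have h := hx.step (n + t) i
    rwa [add_right_comm] at h
  nonneg n i := hx.nonneg _ i
  le_one n i := hx.le_one _ i

theorem IsUnitTrajectory.one_sub (hA : IsStochasticChain A) (hx : IsUnitTrajectory A x) :
    IsUnitTrajectory A (fun n i => 1 - x n i) where
  step n i := by
    simp only [mul_sub, mul_one, Finset.sum_sub_distrib, hA.sum_row, hx.step n i]
  nonneg n i := sub_nonneg.2 (hx.le_one n i)
  le_one n i := sub_le_self _ (hx.nonneg n i)

theorem IsStochasticChain.cutFlow_nonneg (hA : IsStochasticChain A) (S : Finset (Fin N)) (n : ℕ) :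
    0 ≤ cutFlow A S n :=
  Finset.sum_nonneg fun i _ => Finset.sum_nonneg fun j _ =>
    add_nonneg (hA.nonneg n i j) (hA.nonneg n j i)

theorem cutFlow_compl (S : Finset (Fin N)) (n : ℕ) : cutFlow A Sᶜ n = cutFlow A S n := by
  unfold cutFlow
  rw [compl_compl, Finset.sum_comm]
  simp only [add_comm]

theorem IsStochasticChain.dissipation_nonneg (hA : IsStochasticChain A) (n : ℕ) :
    0 ≤ dissipation A x n :=
  Finset.sum_nonneg fun i _ => Finset.sum_nonneg fun j _ =>
    mul_nonneg (hA.nonneg n i j) (sq_nonneg _)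

/-! ### Weights that stay bounded away from zero -/

theorem IsSpread.pow_le {ε : ℝ} {u : Fin N → ℝ} (hu : IsSpread ε u) (i : Fin N) :
    ε ^ (N - 1) ≤ u i := by
  simpa using hu.2 {i} (Finset.singleton_nonempty i)

theorem isSpread_one {ε : ℝ} (h0 : 0 ≤ ε) (h1 : ε ≤ 1) :
    IsSpread ε (fun _ : Fin N => (1 : ℝ)) := by
  refine ⟨fun _ => zero_le_one, fun S hS => (pow_le_one₀ h0 h1).trans ?_⟩
  simpa using hS.card_pos

/-- If every weight outside `S` is at least `Ψ` times every weight inside, then cut-balance makes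
the flow into `S` at least the flow out of it. Otherwise some `j ∉ S` has weight below `Ψ` times
that of a member of `S`, so `S` has already a fixed fraction of the mass of `insert j S`, and
keeps a fraction `δ` of it because of the diagonal. -/
theorem IsSpread.vecMul (hA : IsStochasticChain A) {δ Ψ : ℝ} (hδ : 0 < δ) (hΨ : 0 ≤ Ψ)
    (hdiag : ∀ i n, δ ≤ A n i i)
    (hcut : ∀ (S : Finset (Fin N)) (n : ℕ),
      ∑ i ∈ Sᶜ, ∑ j ∈ S, A n i j ≤ Ψ * ∑ i ∈ S, ∑ j ∈ Sᶜ, A n i j)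
    {u : Fin N → ℝ} (hu : IsSpread (δ / (1 + Ψ)) u) (n : ℕ) :
    IsSpread (δ / (1 + Ψ)) (fun j => ∑ i, u i * A n i j) := by
  refine ⟨fun j => Finset.sum_nonneg fun i _ => mul_nonneg (hu.1 i) (hA.nonneg n i j),
    fun S hS => ?_⟩
  by_cases hgap : ∀ i ∈ S, ∀ j ∉ S, Ψ * u i ≤ u j
  · refine (hu.2 S hS).trans ?_
    obtain ⟨m, hm, hmax⟩ := S.exists_max_image u hS
    have hout : ∑ i ∈ S, u i * ∑ j ∈ Sᶜ, A n i j ≤ u m * ∑ i ∈ S, ∑ j ∈ Sᶜ, A n i j := by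
      rw [Finset.mul_sum]
      exact Finset.sum_le_sum fun i hi => mul_le_mul_of_nonneg_right (hmax i hi)
        (Finset.sum_nonneg fun j _ => hA.nonneg n i j)
    have hin : (Ψ * u m) * ∑ i ∈ Sᶜ, ∑ j ∈ S, A n i j ≤ ∑ i ∈ Sᶜ, u i * ∑ j ∈ S, A n i j := by
      rw [Finset.mul_sum]
      exact Finset.sum_le_sum fun i hi => mul_le_mul_of_nonneg_right
        (hgap m hm i (Finset.mem_compl.1 hi)) (Finset.sum_nonneg fun j _ => hA.nonneg n i j)
    have hbal := hcut Sᶜ n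
    rw [compl_compl] at hbal
    have hbal' := mul_le_mul_of_nonneg_left hbal (hu.1 m)
    have hrow : ∀ i, ∑ j ∈ S, A n i j = 1 - ∑ j ∈ Sᶜ, A n i j := fun i => by
      rw [← hA.sum_row n i, ← Finset.sum_add_sum_compl S]; ring
    have hsplit : ∑ j ∈ S, ∑ i, u i * A n i j
        = ∑ i ∈ S, u i - ∑ i ∈ S, u i * ∑ j ∈ Sᶜ, A n i j
          + ∑ i ∈ Sᶜ, u i * ∑ j ∈ S, A n i j := by
      rw [Finset.sum_comm]
      simp only [← Finset.mul_sum]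
      rw [← Finset.sum_add_sum_compl S, ← Finset.sum_sub_distrib]
      congr 1
      exact Finset.sum_congr rfl fun i _ => by rw [hrow i]; ring
    rw [hsplit]
    linarith
  · push Not at hgap
    obtain ⟨i, hi, j, hj, hij⟩ := hgap
    have hcard : S.card + 1 ≤ N := by
      simpa [Finset.card_insert_of_notMem hj] using Finset.card_le_univ (insert j S)
    have hins := hu.2 (insert j S) (Finset.insert_nonempty j S)
    rw [Finset.card_insert_of_notMem hj, Finset.sum_insert hj] at hins
    have hiS : u i ≤ ∑ i ∈ S, u i := Finset.single_le_sum (fun k _ => hu.1 k) hi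
    have hle : (δ / (1 + Ψ)) ^ (N - (S.card + 1)) ≤ (1 + Ψ) * ∑ i ∈ S, u i := by
      have := mul_le_mul_of_nonneg_left hiS hΨ
      linarith
    calc (δ / (1 + Ψ)) ^ (N - S.card)
        = (δ / (1 + Ψ)) * (δ / (1 + Ψ)) ^ (N - (S.card + 1)) := by
          rw [← pow_succ']; congr 1; omega
      _ ≤ (δ / (1 + Ψ)) * ((1 + Ψ) * ∑ i ∈ S, u i) :=
          mul_le_mul_of_nonneg_left hle (by positivity)
      _ = ∑ i ∈ S, δ * u i := by rw [← Finset.mul_sum]; field_simp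
      _ ≤ ∑ j ∈ S, ∑ i, u i * A n i j := Finset.sum_le_sum fun j _ => by
          calc δ * u j ≤ u j * A n j j := by
                rw [mul_comm]; exact mul_le_mul_of_nonneg_left (hdiag j n) (hu.1 j)
            _ ≤ _ := Finset.single_le_sum (f := fun i => u i * A n i j)
                (fun i _ => mul_nonneg (hu.1 i) (hA.nonneg n i j)) (Finset.mem_univ j)

/-! ### Summability of the dissipation -/

/-- Jensen's inequality for the square, with the gain due to the weight of the index `i`. -/
theorem sq_sum_mul_add_le {ι : Type*} [Fintype ι] [DecidableEq ι] {a z : ι → ℝ} {δ : ℝ} {i : ι}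
    (ha : ∀ j, 0 ≤ a j) (hsum : ∑ j, a j = 1) (hi : δ ≤ a i) :
    (∑ j, a j * z j) ^ 2 + δ * ∑ j, a j * (z i - z j) ^ 2 ≤ ∑ j, a j * z j ^ 2 := by
  -- After subtracting `z i` from `z`, the index `i` drops out of the sum, and Cauchy–Schwarz
  -- applies with total weight `1 - a i`.
  have hcs : (∑ j, a j * (z j - z i)) ^ 2 ≤ (1 - a i) * ∑ j, a j * (z i - z j) ^ 2 := by
    have h1 : ∑ j, a j * (z j - z i) = ∑ j ∈ Finset.univ.erase i, a j * (z j - z i) := by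
      rw [Finset.sum_erase _ (by simp)]
    have h2 : ∑ j, a j * (z i - z j) ^ 2 = ∑ j ∈ Finset.univ.erase i, a j * (z i - z j) ^ 2 := by
      rw [Finset.sum_erase _ (by simp)]
    have h3 : 1 - a i = ∑ j ∈ Finset.univ.erase i, a j := by
      rw [← hsum, ← Finset.add_sum_erase _ a (Finset.mem_univ i)]; ring
    rw [h1, h2, h3]
    refine Finset.sum_sq_le_sum_mul_sum_of_sq_le_mul _ (fun j _ => ha j)
      (fun j _ => mul_nonneg (ha j) (sq_nonneg _)) fun j _ => le_of_eq (by ring)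
  have hmean : ∑ j, a j * (z j - z i) = ∑ j, a j * z j - z i := by
    simp only [mul_sub, Finset.sum_sub_distrib, ← Finset.sum_mul, hsum, one_mul]
  have hsq : ∑ j, a j * (z i - z j) ^ 2
      = ∑ j, a j * z j ^ 2 - 2 * z i * ∑ j, a j * z j + z i ^ 2 := by
    calc _ = ∑ j, (a j * z j ^ 2 - 2 * z i * (a j * z j) + a j * z i ^ 2) :=
          Finset.sum_congr rfl fun j _ => by ring
      _ = _ := by
          rw [Finset.sum_add_distrib, Finset.sum_sub_distrib, ← Finset.mul_sum, ← Finset.sum_mul,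
            hsum, one_mul]
  have hnn : 0 ≤ ∑ j, a j * (z i - z j) ^ 2 :=
    Finset.sum_nonneg fun j _ => mul_nonneg (ha j) (sq_nonneg _)
  have hδ := mul_le_mul_of_nonneg_right hi hnn
  rw [hmean] at hcs
  nlinarith

/-- The weighted sum of squares, with the weights transported by the chain, decreases by at least
a fixed multiple of the dissipation. -/
theorem weighted_sq_add_dissipation_le (hA : IsStochasticChain A) (hx : IsUnitTrajectory A x)
    {δ p : ℝ} (hδ : 0 ≤ δ) (hdiag : ∀ i n, δ ≤ A n i i) {u : Fin N → ℝ} (hp : 0 ≤ p)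
    (hu : ∀ i, p ≤ u i) (n : ℕ) :
    ∑ i, u i * x (n + 1) i ^ 2 + p * δ * dissipation A x n
      ≤ ∑ j, (∑ i, u i * A n i j) * x n j ^ 2 := by
  have hcol : ∑ j, (∑ i, u i * A n i j) * x n j ^ 2 = ∑ i, u i * ∑ j, A n i j * x n j ^ 2 := by
    simp only [Finset.sum_mul, Finset.mul_sum]
    rw [Finset.sum_comm]
    simp only [mul_assoc]
  rw [hcol, dissipation, Finset.mul_sum, ← Finset.sum_add_distrib]
  refine Finset.sum_le_sum fun i _ => ?_
  have hJ := mul_le_mul_of_nonneg_left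
    (sq_sum_mul_add_le (z := x n) (hA.nonneg n i) (hA.sum_row n i) (hdiag i n))
    (hp.trans (hu i))
  have hD : 0 ≤ δ * ∑ j, A n i j * (x n i - x n j) ^ 2 :=
    mul_nonneg hδ (Finset.sum_nonneg fun j _ => mul_nonneg (hA.nonneg n i j) (sq_nonneg _))
  have := mul_le_mul_of_nonneg_right (hu i) hD
  rw [hx.step n i]
  linarith

/-- For every horizon, spread weights at the initial time bound the dissipation up to the horizon.
They are obtained by transporting the constant weight `1` back from the horizon. -/
theorem exists_weights_dissipation_le (hA : IsStochasticChain A)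
    {δ Ψ : ℝ} (hδ : 0 < δ) (hδ1 : δ ≤ 1) (hΨ : 0 ≤ Ψ) (hdiag : ∀ i n, δ ≤ A n i i)
    (hcut : ∀ (S : Finset (Fin N)) (n : ℕ),
      ∑ i ∈ Sᶜ, ∑ j ∈ S, A n i j ≤ Ψ * ∑ i ∈ S, ∑ j ∈ Sᶜ, A n i j)
    (hx : IsUnitTrajectory A x) (K : ℕ) :
    ∃ u : Fin N → ℝ, IsSpread (δ / (1 + Ψ)) u ∧ ∑ i, u i = N ∧
      (δ / (1 + Ψ)) ^ (N - 1) * δ * ∑ n ∈ Finset.range K, dissipation A x n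
        ≤ ∑ i, u i * x 0 i ^ 2 := by
  have hε0 : 0 ≤ δ / (1 + Ψ) := by positivity
  have hε1 : δ / (1 + Ψ) ≤ 1 := (div_le_one (by positivity)).2 (by linarith)
  induction K generalizing A x with
  | zero =>
    exact ⟨fun _ => 1, isSpread_one hε0 hε1, by simp,
      by simpa using Finset.sum_nonneg fun i _ => sq_nonneg (x 0 i)⟩
  | succ K ih =>
    obtain ⟨u, hu, hsum, hle⟩ := ih (hA.shift 1) (fun i n => hdiag i (n + 1))
      (fun S n => hcut S (n + 1)) (hx.shift 1)
    refine ⟨_, hu.vecMul hA hδ hΨ hdiag hcut 0, ?_, ?_⟩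
    · rw [Finset.sum_comm]
      simp only [← Finset.mul_sum, hA.sum_row, mul_one, hsum]
    · have hstep := weighted_sq_add_dissipation_le hA hx hδ.le hdiag (pow_nonneg hε0 _) hu.pow_le 0
      rw [Finset.sum_range_succ', mul_add]
      refine le_trans (add_le_add_left hle _) ?_
      simpa using hstep

theorem summable_dissipation (hA : IsStochasticChain A) (hsc : IsSelfConfident A)
    (hcb : IsCutBalanced A) (hx : IsUnitTrajectory A x) : Summable (dissipation A x) := by
  obtain ⟨δ, hδ, hdiag⟩ := hsc
  obtain ⟨Ψ, hcut⟩ := hcb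
  have hδ' : 0 < min δ 1 := lt_min hδ one_pos
  have hΨ' : 0 ≤ max Ψ 0 := le_max_right _ _
  have hc : 0 < (min δ 1 / (1 + max Ψ 0)) ^ (N - 1) * min δ 1 := by positivity
  refine summable_of_sum_range_le (c := N / ((min δ 1 / (1 + max Ψ 0)) ^ (N - 1) * min δ 1))
    (fun n => hA.dissipation_nonneg n) fun K => ?_
  obtain ⟨u, hu, hsum, hle⟩ := exists_weights_dissipation_le hA hδ' (min_le_right _ _) hΨ'
    (fun i n => (min_le_left _ _).trans (hdiag i n))
    (fun S n => (hcut S n).trans (mul_le_mul_of_nonneg_right (le_max_left _ _)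
      (Finset.sum_nonneg fun i _ => Finset.sum_nonneg fun j _ => hA.nonneg n i j))) hx K
  rw [le_div_iff₀' hc]
  refine hle.trans (hsum ▸ Finset.sum_le_sum fun i _ => mul_le_of_le_one_right (hu.1 i) ?_)
  exact pow_le_one₀ (hx.nonneg 0 i) (hx.le_one 0 i)

/-! ### Drift of a set of coordinates -/

/-- The maximum of a trajectory over `S` increases by at most the flow across the cut of `S`. -/
theorem IsUnitTrajectory.le_add_sum_cutFlow (hA : IsStochasticChain A) (hx : IsUnitTrajectory A x)
    {S : Finset (Fin N)} {c : ℝ} (hc : 0 ≤ c) (h0 : ∀ i ∈ S, x 0 i ≤ c) (n : ℕ) :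
    ∀ i ∈ S, x n i ≤ c + ∑ m ∈ Finset.range n, cutFlow A S m := by
  induction n with
  | zero => simpa using h0
  | succ n ih =>
    intro i hi
    set C := c + ∑ m ∈ Finset.range n, cutFlow A S m with hC
    have hC0 : 0 ≤ C := add_nonneg hc (Finset.sum_nonneg fun m _ => hA.cutFlow_nonneg S m)
    have hin : ∑ j ∈ S, A n i j * x n j ≤ C := by
      calc ∑ j ∈ S, A n i j * x n j ≤ ∑ j ∈ S, A n i j * C :=
            Finset.sum_le_sum fun j hj => mul_le_mul_of_nonneg_left (ih j hj) (hA.nonneg n i j)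
        _ ≤ ∑ j, A n i j * C := Finset.sum_le_sum_of_subset_of_nonneg (Finset.subset_univ S)
            fun j _ _ => mul_nonneg (hA.nonneg n i j) hC0
        _ = C := by rw [← Finset.sum_mul, hA.sum_row, one_mul]
    have hout : ∑ j ∈ Sᶜ, A n i j * x n j ≤ cutFlow A S n := by
      calc ∑ j ∈ Sᶜ, A n i j * x n j ≤ ∑ j ∈ Sᶜ, (A n i j + A n j i) :=
            Finset.sum_le_sum fun j _ =>
              (mul_le_of_le_one_right (hA.nonneg n i j) (hx.le_one n j)).trans
                (le_add_of_nonneg_right (hA.nonneg n j i))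
        _ ≤ cutFlow A S n := Finset.single_le_sum
            (f := fun i => ∑ j ∈ Sᶜ, (A n i j + A n j i))
            (fun i _ => Finset.sum_nonneg fun j _ =>
              add_nonneg (hA.nonneg n i j) (hA.nonneg n j i)) hi
    rw [Finset.sum_range_succ, ← add_assoc, ← hC, hx.step n i, ← Finset.sum_add_sum_compl S]
    exact add_le_add hin hout

theorem IsUnitTrajectory.sub_sum_cutFlow_le (hA : IsStochasticChain A) (hx : IsUnitTrajectory A x)
    {S : Finset (Fin N)} {c : ℝ} (hc : c ≤ 1) (h0 : ∀ i ∈ S, c ≤ x 0 i) (n : ℕ) :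
    ∀ i ∈ S, c - ∑ m ∈ Finset.range n, cutFlow A S m ≤ x n i := by
  intro i hi
  have := (hx.one_sub hA).le_add_sum_cutFlow hA (sub_nonneg.2 hc)
    (fun i hi => sub_le_sub_left (h0 i hi) 1) n i hi
  linarith

/-! ### Persistence of gaps -/

theorem mul_cutFlow_le_dissipation (hA : IsStochasticChain A) {S : Finset (Fin N)} {g : ℝ} {n : ℕ}
    (hg : 0 ≤ g) (h : ∀ i ∈ S, ∀ j ∉ S, x n i + g ≤ x n j) :
    g ^ 2 * cutFlow A S n ≤ dissipation A x n := by
  have hsq : ∀ i ∈ S, ∀ j ∈ Sᶜ, g ^ 2 ≤ (x n i - x n j) ^ 2 := fun i hi j hj => by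
    have := h i hi j (Finset.mem_compl.1 hj)
    nlinarith
  have hnn : ∀ i j, 0 ≤ A n i j * (x n i - x n j) ^ 2 := fun i j =>
    mul_nonneg (hA.nonneg n i j) (sq_nonneg _)
  calc g ^ 2 * cutFlow A S n
      = ∑ i ∈ S, ∑ j ∈ Sᶜ, A n i j * g ^ 2 + ∑ i ∈ Sᶜ, ∑ j ∈ S, A n i j * g ^ 2 := by
        rw [Finset.sum_comm (s := Sᶜ), ← Finset.sum_add_distrib, cutFlow, Finset.mul_sum]
        refine Finset.sum_congr rfl fun i _ => ?_
        rw [← Finset.sum_add_distrib, Finset.mul_sum]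
        exact Finset.sum_congr rfl fun j _ => by ring
    _ ≤ ∑ i ∈ S, ∑ j ∈ Sᶜ, A n i j * (x n i - x n j) ^ 2
        + ∑ i ∈ Sᶜ, ∑ j ∈ S, A n i j * (x n i - x n j) ^ 2 := by
        refine add_le_add
          (Finset.sum_le_sum fun i hi => Finset.sum_le_sum fun j hj =>
            mul_le_mul_of_nonneg_left (hsq i hi j hj) (hA.nonneg n i j))
          (Finset.sum_le_sum fun i hi => Finset.sum_le_sum fun j hj =>
            mul_le_mul_of_nonneg_left ?_ (hA.nonneg n i j))
        rw [← neg_sub, neg_sq]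
        exact hsq j hj i hi
    _ ≤ ∑ i ∈ S, ∑ j, A n i j * (x n i - x n j) ^ 2
        + ∑ i ∈ Sᶜ, ∑ j, A n i j * (x n i - x n j) ^ 2 :=
        add_le_add
          (Finset.sum_le_sum fun i _ => Finset.sum_le_sum_of_subset_of_nonneg
            (Finset.subset_univ _) fun j _ _ => hnn i j)
          (Finset.sum_le_sum fun i _ => Finset.sum_le_sum_of_subset_of_nonneg
            (Finset.subset_univ _) fun j _ _ => hnn i j)
    _ = dissipation A x n := Finset.sum_add_sum_compl S _

/-- A gap `g` across a cut persists, up to a factor `2`, if the total dissipation is small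
compared with `g`: as long as it persists, the dissipation controls the flow across the cut,
and this flow controls how far the two sides can drift. Hence the flow across the cut is
summable. -/
theorem summable_cutFlow_of_gap (hA : IsStochasticChain A) (hx : IsUnitTrajectory A x)
    (hd : Summable (dissipation A x)) {g : ℝ} (hg : 0 < g)
    (hsmall : ∑' n, dissipation A x n ≤ g ^ 3 / 16) {S : Finset (Fin N)}
    (hgap : ∀ i ∈ S, ∀ j ∉ S, x 0 i + g ≤ x 0 j) : Summable (cutFlow A S) := by
  rcases S.eq_empty_or_nonempty with rfl | hS
  · have : cutFlow A ∅ = 0 := by ext n; simp [cutFlow]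
    rw [this]; exact summable_zero
  obtain ⟨m, hm, hmax⟩ := S.exists_max_image (x 0) hS
  have hpart : ∀ n, ∑ k ∈ Finset.range n, dissipation A x k ≤ g ^ 3 / 16 := fun n =>
    (hd.sum_le_tsum _ fun k _ => hA.dissipation_nonneg k).trans hsmall
  have hflow : ∀ n, (g / 2) ^ 2 * ∑ k ∈ Finset.range n, cutFlow A S k
      ≤ ∑ k ∈ Finset.range n, dissipation A x k := by
    intro n
    induction n with
    | zero => simp
    | succ n ih =>
      have hF : ∑ k ∈ Finset.range n, cutFlow A S k ≤ g / 4 := by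
        have h := ih.trans (hpart n)
        have hpos : 0 < (g / 2) ^ 2 := by positivity
        refine le_of_mul_le_mul_left (h.trans (le_of_eq ?_)) hpos
        ring
      rw [Finset.sum_range_succ, Finset.sum_range_succ, mul_add]
      refine add_le_add ih (mul_cutFlow_le_dissipation hA (by positivity) fun i hi j hj => ?_)
      have hup := hx.le_add_sum_cutFlow hA (hx.nonneg 0 m) hmax n i hi
      have hlow := hx.sub_sum_cutFlow_le hA (S := Sᶜ)
        ((hgap m hm j hj).trans (hx.le_one 0 j))
        (fun k hk => hgap m hm k (Finset.mem_compl.1 hk)) n j (Finset.mem_compl.2 hj)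
      simp only [cutFlow_compl] at hlow
      linarith
  refine summable_of_sum_range_le (c := g ^ 3 / 16 / (g / 2) ^ 2)
    (fun n => hA.cutFlow_nonneg S n) fun n => ?_
  rw [le_div_iff₀' (by positivity)]
  exact (hflow n).trans (hpart n)

/-- Among `N` reals, two of which differ by more than `N * g`, there is a gap of length `g`
between them. -/
theorem exists_gap {y : Fin N → ℝ} {g : ℝ} {i j : Fin N} (hg : 0 ≤ g)
    (hij : y i + N * g < y j) :
    ∃ S : Finset (Fin N), i ∈ S ∧ j ∉ S ∧ ∀ a ∈ S, ∀ b ∉ S, y a + g ≤ y b := by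
  classical
  by_contra! hno
  -- Without a gap, each threshold `y i + m * g` has one more value below it than the last one.
  have hcard : ∀ m ≤ N, m + 1 ≤ (Finset.univ.filter fun a => y a ≤ y i + m * g).card := by
    intro m hm
    induction m with
    | zero => exact Finset.card_pos.2 ⟨i, by simp⟩
    | succ m ih =>
      have hmN : (m : ℝ) * g ≤ N * g :=
        mul_le_mul_of_nonneg_right (by exact_mod_cast (Nat.le_succ m).trans hm) hg
      obtain ⟨a, ha, b, hb, hab⟩ := hno (Finset.univ.filter fun a => y a ≤ y i + m * g)
        (by simpa using by positivity) (by simpa using by linarith)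
      simp only [Finset.mem_filter, Finset.mem_univ, true_and, not_le] at ha hb
      refine (Nat.succ_le_succ (ih ((Nat.le_succ m).trans hm))).trans
        (Nat.succ_le_of_lt (Finset.card_lt_card (Finset.ssubset_iff_of_subset ?_ |>.2 ⟨b, ?_, ?_⟩)))
      · intro k hk
        simp only [Finset.mem_filter, Finset.mem_univ, true_and] at hk ⊢
        push_cast
        linarith
      · simp only [Finset.mem_filter, Finset.mem_univ, true_and]
        push_cast
        linarith
      · simpa using hb
  have h1 := hcard N le_rfl
  have h2 := Finset.card_le_univ (Finset.univ.filter fun a => y a ≤ y i + N * g)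
  rw [Fintype.card_fin] at h2
  omega

/-! ### Islands -/

theorem infiniteFlowGraph_adj_iff (hA : IsStochasticChain A) {i j : Fin N} :
    (infiniteFlowGraph A).Adj i j ↔ i ≠ j ∧ ¬ Summable fun n => A n i j + A n j i :=
  and_congr_right fun _ => (not_summable_iff_tendsto_nat_atTop_of_nonneg fun n =>
    add_nonneg (hA.nonneg n i j) (hA.nonneg n j i)).symm

theorem infiniteFlowGraph_shift (hA : IsStochasticChain A) (t : ℕ) :
    infiniteFlowGraph (fun n => A (n + t)) = infiniteFlowGraph A := by
  ext i j
  rw [infiniteFlowGraph_adj_iff hA, infiniteFlowGraph_adj_iff (hA.shift t),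
    summable_nat_add_iff (f := fun n => A n i j + A n j i)]

open Classical in
/-- The island of `i`, as a finite set. -/
noncomputable def islandOf (A : ℕ → Matrix (Fin N) (Fin N) ℝ) (i : Fin N) : Finset (Fin N) :=
  Finset.univ.filter fun j => (infiniteFlowGraph A).Reachable i j

theorem mem_islandOf {i j : Fin N} :
    j ∈ islandOf A i ↔ (infiniteFlowGraph A).Reachable i j := by
  simp [islandOf]

theorem summable_cutFlow_islandOf (hA : IsStochasticChain A) (i : Fin N) :
    Summable (cutFlow A (islandOf A i)) := by
  refine summable_sum fun a ha => summable_sum fun b hb => ?_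
  rw [mem_islandOf] at ha
  rw [Finset.mem_compl, mem_islandOf] at hb
  by_contra hns
  have hab : a ≠ b := by rintro rfl; exact hb ha
  exact hb (ha.trans ((infiniteFlowGraph_adj_iff hA).2 ⟨hab, hns⟩).reachable)

theorem not_summable_cutFlow_of_adj (hA : IsStochasticChain A) {i j : Fin N}
    (h : (infiniteFlowGraph A).Adj i j) {S : Finset (Fin N)} (hi : i ∈ S) (hj : j ∉ S) :
    ¬ Summable (cutFlow A S) := fun hs => by
  refine ((infiniteFlowGraph_adj_iff hA).1 h).2 (Summable.of_nonneg_of_le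
    (fun n => add_nonneg (hA.nonneg n i j) (hA.nonneg n j i)) (fun n => ?_) hs)
  calc A n i j + A n j i ≤ ∑ j ∈ Sᶜ, (A n i j + A n j i) :=
        Finset.single_le_sum (f := fun j => A n i j + A n j i)
          (fun k _ => add_nonneg (hA.nonneg n i k) (hA.nonneg n k i)) (Finset.mem_compl.2 hj)
    _ ≤ cutFlow A S n := Finset.single_le_sum (f := fun i => ∑ j ∈ Sᶜ, (A n i j + A n j i))
        (fun k _ => Finset.sum_nonneg fun l _ => add_nonneg (hA.nonneg n k l) (hA.nonneg n l k)) hi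

/-- Once the remaining dissipation is small, a large difference between two adjacent indices
would contain a gap that separates them, although the flow between them is not summable. -/
theorem eventually_sub_le_of_adj (hA : IsStochasticChain A) (hx : IsUnitTrajectory A x)
    (hd : Summable (dissipation A x)) {i j : Fin N} (h : (infiniteFlowGraph A).Adj i j)
    {η : ℝ} (hη : 0 < η) : ∀ᶠ t in atTop, x t j - x t i ≤ η := by
  have hN : (0 : ℝ) < N := by exact_mod_cast i.pos
  have hg : 0 < η / N := by positivity
  filter_upwards [(tendsto_sum_nat_add (dissipation A x)).eventually_le_const
    (show 0 < (η / N) ^ 3 / 16 by positivity)] with t ht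
  by_contra! hlt
  obtain ⟨S, hi, hj, hS⟩ := exists_gap (y := x t) (g := η / N) (i := i) (j := j) hg.le
    (by rw [mul_div_cancel₀ _ hN.ne']; linarith)
  have hdt : Summable (dissipation (fun n => A (n + t)) fun n => x (n + t)) :=
    (summable_nat_add_iff (f := dissipation A x) t).2 hd
  have hs : Summable (cutFlow (fun n => A (n + t)) S) :=
    summable_cutFlow_of_gap (hA.shift t) (hx.shift t) hdt hg ht (by simpa only [zero_add] using hS)
  exact not_summable_cutFlow_of_adj hA h hi hj ((summable_nat_add_iff (f := cutFlow A S) t).1 hs)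

theorem tendsto_sub_of_reachable (hA : IsStochasticChain A) (hx : IsUnitTrajectory A x)
    (hd : Summable (dissipation A x)) {i j : Fin N} (h : (infiniteFlowGraph A).Reachable i j) :
    Tendsto (fun t => x t i - x t j) atTop (𝓝 0) := by
  obtain ⟨w⟩ := h
  induction w with
  | nil => simp
  | @cons a b c hab _ ih =>
    have hstep : Tendsto (fun t => x t a - x t b) atTop (𝓝 0) := by
      rw [Metric.tendsto_nhds]
      intro η hη
      filter_upwards [eventually_sub_le_of_adj hA hx hd hab (half_pos hη),
        eventually_sub_le_of_adj hA hx hd hab.symm (half_pos hη)] with t h1 h2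
      rw [Real.dist_eq, sub_zero, abs_lt]
      constructor <;> linarith
    simpa using hstep.add ih

/-- On an island, all values are close together at a late time, and afterwards they drift by no
more than the flow that still crosses the border of the island. -/
theorem IsUnitTrajectory.exists_tendsto (hA : IsStochasticChain A) (hx : IsUnitTrajectory A x)
    (hd : Summable (dissipation A x)) (i : Fin N) : ∃ l, Tendsto (fun t => x t i) atTop (𝓝 l) := by
  refine cauchySeq_tendsto_of_complete (Metric.cauchySeq_iff'.2 fun η hη => ?_)
  have hI := summable_cutFlow_islandOf hA i
  have hclose : ∀ᶠ t in atTop, ∀ j ∈ islandOf A i, |x t i - x t j| < η / 2 := by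
    rw [Filter.eventually_all_finset]
    intro j hj
    have := (tendsto_sub_of_reachable hA hx hd (mem_islandOf.1 hj)).abs
    rw [abs_zero] at this
    exact this.eventually_lt_const (half_pos hη)
  obtain ⟨t, ht, hclose⟩ := (((tendsto_sum_nat_add (cutFlow A (islandOf A i))).eventually_lt_const
    (half_pos hη)).and hclose).exists
  refine ⟨t, fun n hn => ?_⟩
  obtain ⟨k, rfl⟩ := Nat.exists_eq_add_of_le' hn
  have hi : i ∈ islandOf A i := mem_islandOf.2 (SimpleGraph.Reachable.refl i)
  have hpart : ∑ m ∈ Finset.range k, cutFlow (fun n => A (n + t)) (islandOf A i) m < η / 2 :=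
    (((summable_nat_add_iff t).2 hI).sum_le_tsum _ fun m _ => hA.cutFlow_nonneg _ _).trans_lt ht
  obtain ⟨a, ha, hmax⟩ := (islandOf A i).exists_max_image (x t) ⟨i, hi⟩
  obtain ⟨b, hb, hmin⟩ := (islandOf A i).exists_min_image (x t) ⟨i, hi⟩
  have hup := (hx.shift t).le_add_sum_cutFlow (hA.shift t) (S := islandOf A i) (hx.nonneg t a)
    (by simpa using hmax) k i hi
  have hlow := (hx.shift t).sub_sum_cutFlow_le (hA.shift t) (S := islandOf A i) (hx.le_one t b)
    (by simpa using hmin) k i hi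
  have h1 := abs_lt.1 (hclose a ha)
  have h2 := abs_lt.1 (hclose b hb)
  rw [Real.dist_eq, abs_lt]
  constructor <;> linarith

/-! ### Backward products -/

open Matrix in
theorem isUnitTrajectory_backwardProd (hA : IsStochasticChain A) (n₀ : ℕ) {v : Fin N → ℝ}
    (h0 : ∀ i, 0 ≤ v i) (h1 : ∀ i, v i ≤ 1) :
    IsUnitTrajectory (fun n => A (n + n₀)) (fun n => backwardProd A n₀ n *ᵥ v) := by
  have hstep : ∀ n i, (backwardProd A n₀ (n + 1) *ᵥ v) i
      = ∑ j, A (n + n₀) i j * (backwardProd A n₀ n *ᵥ v) j := fun n i => by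
    rw [backwardProd, ← mulVec_mulVec, add_comm n₀ n]
    rfl
  refine ⟨hstep, fun n => ?_, fun n => ?_⟩
  · induction n with
    | zero => simpa [backwardProd] using h0
    | succ n ih =>
      intro i
      rw [hstep]
      exact Finset.sum_nonneg fun j _ => mul_nonneg (hA.nonneg _ i j) (ih j)
  · induction n with
    | zero => simpa [backwardProd] using h1
    | succ n ih =>
      intro i
      rw [hstep, ← hA.sum_row (n + n₀) i]
      exact Finset.sum_le_sum fun j _ => mul_le_of_le_one_right (hA.nonneg _ i j) (ih j)

theorem IsSelfConfident.shift (h : IsSelfConfident A) (t : ℕ) :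
    IsSelfConfident (fun n => A (n + t)) :=
  let ⟨δ, hδ, h⟩ := h
  ⟨δ, hδ, fun i n => h i (n + t)⟩

theorem IsCutBalanced.shift (h : IsCutBalanced A) (t : ℕ) :
    IsCutBalanced (fun n => A (n + t)) :=
  let ⟨Ψ, h⟩ := h
  ⟨Ψ, fun S n => h S (n + t)⟩

open Matrix in
/-- The columns of the backward products are trajectories. -/
theorem isUnitTrajectory_col (hA : IsStochasticChain A) (n₀ : ℕ) (j : Fin N) :
    IsUnitTrajectory (fun n => A (n + n₀)) (fun n i => backwardProd A n₀ n i j) := by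
  have h := isUnitTrajectory_backwardProd hA n₀ (v := Pi.single j 1)
    (fun i => by rw [Pi.single_apply]; split_ifs <;> norm_num)
    (fun i => by rw [Pi.single_apply]; split_ifs <;> norm_num)
  simp only [mulVec_single_one] at h
  exact h

theorem exists_tendsto_backwardProd (hA : IsStochasticChain A) (hsc : IsSelfConfident A)
    (hcb : IsCutBalanced A) (n₀ : ℕ) :
    ∃ L : Matrix (Fin N) (Fin N) ℝ, Tendsto (backwardProd A n₀) atTop (𝓝 L) := by
  choose L hL using fun i j => (isUnitTrajectory_col hA n₀ j).exists_tendsto (hA.shift n₀)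
    (summable_dissipation (hA.shift n₀) (hsc.shift n₀) (hcb.shift n₀)
      (isUnitTrajectory_col hA n₀ j)) i
  exact ⟨L, tendsto_pi_nhds.2 fun i => tendsto_pi_nhds.2 fun j => hL i j⟩

theorem mutuallyErgodic_of_reachable (hA : IsStochasticChain A) (hsc : IsSelfConfident A)
    (hcb : IsCutBalanced A) {i j : Fin N} (h : (infiniteFlowGraph A).Reachable i j) :
    MutuallyErgodic A i j := fun n₀ => tendsto_pi_nhds.2 fun k =>
  tendsto_sub_of_reachable (hA.shift n₀) (isUnitTrajectory_col hA n₀ k)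
    (summable_dissipation (hA.shift n₀) (hsc.shift n₀) (hcb.shift n₀)
      (isUnitTrajectory_col hA n₀ k)) (by rwa [infiniteFlowGraph_shift hA])

open Matrix in
/-- The indicator of the complement of an island, started when the remaining flow across the
border of the island is below `1 / 4`, stays below `1 / 4` on the island and above `3 / 4`
outside. -/
theorem MutuallyErgodic.reachable (hA : IsStochasticChain A) {i j : Fin N}
    (h : MutuallyErgodic A i j) : (infiniteFlowGraph A).Reachable i j := by
  by_contra hij
  set I := islandOf A i with hIdef
  have hi : i ∈ I := mem_islandOf.2 (SimpleGraph.Reachable.refl i)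
  have hj : j ∉ I := fun hj => hij (mem_islandOf.1 hj)
  have hI := summable_cutFlow_islandOf hA i
  obtain ⟨t, ht⟩ := ((tendsto_sum_nat_add (cutFlow A I)).eventually_lt_const
    (show (0 : ℝ) < 1 / 4 by norm_num)).exists
  have hpart : ∀ k, ∑ m ∈ Finset.range k, cutFlow (fun n => A (n + t)) I m < 1 / 4 := fun k =>
    (((summable_nat_add_iff t).2 hI).sum_le_tsum _ fun m _ => hA.cutFlow_nonneg _ _).trans_lt ht
  set v : Fin N → ℝ := fun k => if k ∈ I then 0 else 1 with hv
  have hx := isUnitTrajectory_backwardProd hA t (v := v)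
    (fun k => by simp only [hv]; split_ifs <;> norm_num)
    (fun k => by simp only [hv]; split_ifs <;> norm_num)
  have hlim : Tendsto (fun k => (backwardProd A t k *ᵥ v) i - (backwardProd A t k *ᵥ v) j)
      atTop (𝓝 0) := by
    have := tendsto_finsetSum Finset.univ fun k (_ : k ∈ Finset.univ) =>
      (tendsto_pi_nhds.1 (h t) k).mul_const (v k)
    simpa [mulVec, dotProduct, sub_mul] using this
  obtain ⟨k, hk⟩ := (hlim.eventually_const_lt (show (-(1 / 2) : ℝ) < 0 by norm_num)).exists
  have hup := hx.le_add_sum_cutFlow (hA.shift t) (S := I) le_rfl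
    (fun a ha => by simp [backwardProd, hv, ha]) k i hi
  have hlow := hx.sub_sum_cutFlow_le (hA.shift t) (S := Iᶜ) le_rfl
    (fun a ha => by simp [backwardProd, hv, Finset.mem_compl.1 ha]) k j (Finset.mem_compl.2 hj)
  simp only [cutFlow_compl] at hlow
  have := hpart k
  linarith

theorem isErgodicClassPartition_islands (hA : IsStochasticChain A) (hsc : IsSelfConfident A)
    (hcb : IsCutBalanced A) : IsErgodicClassPartition A (islands A) := by
  refine ⟨⟨?_, fun i => ?_⟩, fun i j => ⟨?_, fun h => ?_⟩⟩
  · rintro ⟨c, hc⟩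
    exact c.nonempty_supp.ne_empty hc
  · refine ⟨((infiniteFlowGraph A).connectedComponentMk i).supp, ⟨⟨_, rfl⟩, rfl⟩, ?_⟩
    rintro _ ⟨⟨c, rfl⟩, hi⟩
    rw [SimpleGraph.ConnectedComponent.mem_supp_iff] at hi
    rw [hi]
  · rintro ⟨_, ⟨c, rfl⟩, hi, hj⟩
    exact mutuallyErgodic_of_reachable hA hsc hcb (c.reachable_of_mem_supp hi hj)
  · refine ⟨_, ⟨(infiniteFlowGraph A).connectedComponentMk j, rfl⟩, ?_, rfl⟩
    exact SimpleGraph.ConnectedComponent.sound (h.reachable hA)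

theorem theorem6 (N : ℕ) (A : ℕ → Matrix (Fin N) (Fin N) ℝ)
    (hA : IsStochasticChain A) (hsc : IsSelfConfident A) (hcb : IsCutBalanced A) :
    IsClassErgodic A ∧ IsErgodicClassPartition A (islands A) :=
  ⟨⟨exists_tendsto_backwardProd hA hsc hcb, islands A, isErgodicClassPartition_islands hA hsc hcb⟩,
    isErgodicClassPartition_islands hA hsc hcb⟩
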